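/- **Setting.** A network is a finite directed acyclic multigraph with distinct source nodes $\sigma_1,\dots,\sigma_s$ that have no incoming edges, and a sink $\gamma$ that is not a source, such that every other node has a directed path to $\gamma$. Let $f:\mathcal A^s\to\mathcal O$ (target function) and $g:\mathcal A^s\to\mathcal Q$ (security function) be given, and let each edge carry symbols from a finite nonempty alphabet $\mathcal B$. An $(\ell,n)$ code (with $\ell\ge 0$, $n\ge1$) consists of nonempty finite key sets $\mathcal K_1,\dots,\mathcal K_s$; for each edge leaving $\sigma_i$ a map $\mathcal A^\ell\times\mathcal K_i\to\mathcal B^n$; for every other edge $e$ a map from the tuple of messages in $\mathcal B^n$ on the edges entering the tail of $e$ to $\mathcal B^n$; and a decoding map from the messages on the edges entering $\gamma$ to $\mathcal O^\ell$. The source messages $M_i\in\mathcal A^\ell$ and the keys $K_i\in\mathcal K_i$ are independent and uniform; $Y_e$ is the resulting message on the edge $e$, $Y_W=(Y_e)_{e\in W}$, and $f(M_S)\in\mathcal O^\ell$, $g(M_S)\in\mathcal Q^\ell$ are obtained by applying $f$, $g$ to each of the $\ell$ coordinates. The code is admissible at security level $r$ if the decoder outputs $f(M_S)$ for every realization of messages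 and keys, and $I(Y_W;g(M_S))=0$ (Shannon mutual information) for every set $W$ of at most $r$ edges. A real $R\ge0$ is achievable if for every $\epsilon>0$ there is an admissible $(\ell,n)$ code with $\ell/n>R-\epsilon$, and the secure computing capacity $\widehat{\mathcal C}(\mathcal N,f,g,r)\in[0,\infty]$ is the largest achievable rate ($\infty$ if all rates are achievable). A $(U,V,\alpha)$-tree is a three-layer network with sources $\sigma_{i,j}$ ($i\in[U]$, $j\in[V]$), middle nodes $v_1,\dots,v_U$ and sink $\gamma$, with exactly $\alpha$ parallel edges from $\sigma_{i,j}$ to $v_i$ and from $v_i$ to $\gamma$ for all $i,j$, and no other nodes or edges. Its $i$-th branch $\mathcal N_i$ is the subnetwork on $\{v_i,\gamma\}\cup\{\sigma_{i,j}:j\in[V]\}$ with all edges between these nodes. **Theorem.** Let $\mathcal N$ be a $(U,V,\alpha)$-tree with $U\ge1$, let $\mathbb F_q$ be a finite field, let $f(\mathbf x)=\mathbf x\mathbf F$ and $g(\mathbf x)=\mathbf x\mathbf G$ with $\mathbf F\in\mathbb F_q^{UV\times r_f}$ and $\mathbf G\in\mathbb F_q^{UV\times r_g}$ be the target and security functions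 ($\mathcal A=\mathbb F_q$), and let $f_i(\mathbf x)=\mathbf x\mathbf F_i$, $g_i(\mathbf x)=\mathbf x\mathbf G_i$, where $\mathbf F_i,\mathbf G_i$ consist of the rows of $\mathbf F,\mathbf G$ belonging to the sources of $\mathcal N_i$. Then for every integer $r\ge0$, $$\widehat{\mathcal C}(\mathcal N,f,g,r)\ \ge\ \min_{\substack{r_1,\dots,r_U\in\mathbb Z_{\ge0}\\ r_1+\cdots+r_U=r}}\ \min_{i\in[U]}\widehat{\mathcal C}(\mathcal N_i,f_i,g_i,r_i)\ =\ \min_{i\in[U]}\widehat{\mathcal C}(\mathcal N_i,f_i,g_i,r).$$ -/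

import Mathlib

/-- A network over a finite directed acyclic multigraph with vertices `𝒱` and edges `ℰ`,
source nodes indexed by `ι`, and one sink. -/
structure Network (ι 𝒱 ℰ : Type*) where
  /-- The node at which an edge starts. -/
  tail : ℰ → 𝒱
  /-- The node at which an edge ends. -/
  head : ℰ → 𝒱
  /-- The (pairwise distinct) source nodes. -/
  source : ι ↪ 𝒱
  /-- The sink node. -/
  sink : 𝒱
  /-- There is no directed cycle. -/
  acyclic : ∀ v, ¬ Relation.TransGen (fun u w => ∃ e, tail e = u ∧ head e = w) v v
  /-- The sink is not a source node. -/
  sink_ne_source : ∀ i, sink ≠ source i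
  /-- Source nodes have no incoming edges. -/
  head_ne_source : ∀ e i, head e ≠ source i
  /-- Every node other than the sink has a directed path to the sink. -/
  path_to_sink : ∀ u, u ≠ sink →
    Relation.TransGen (fun u w => ∃ e, tail e = u ∧ head e = w) u sink

namespace Network

variable {ι 𝒱 ℰ : Type*}

theorem wellFounded_edge [Finite ℰ] (N : Network ι 𝒱 ℰ) :
    WellFounded (fun d e : ℰ => N.head d = N.tail e) := by
  have hirr : ∀ e, ¬ Relation.TransGen (fun d e : ℰ => N.head d = N.tail e) e e := by
    intro e he
    exact N.acyclic (N.tail e)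
      (Relation.TransGen.lift (p := fun u w => ∃ e, N.tail e = u ∧ N.head e = w) N.tail
        (fun a b h => ⟨a, rfl, h⟩) _ _ he)
  have : Std.Irrefl (Relation.TransGen (fun d e : ℰ => N.head d = N.tail e)) := ⟨hirr⟩
  exact (Finite.wellFounded_of_trans_of_irrefl
    (Relation.TransGen (fun d e : ℰ => N.head d = N.tail e))).mono
      (fun _ _ h => Relation.TransGen.single h)

/-- An `(ℓ, n)` network code with random keys: source symbols from `A`, edge symbols from `B`,
values of the target function in `O`, and the key of the `i`-th source in `K i`. -/
structure Code (N : Network ι 𝒱 ℰ) (A B O : Type*) (ℓ n : ℕ) (K : ι → Type) where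
  /-- Local encoding function of an edge that leaves the `i`-th source node. -/
  encSource : ∀ i, {e : ℰ // N.tail e = N.source i} → (Fin ℓ → A) → K i → (Fin n → B)
  /-- Local encoding function of an edge that leaves a node which is not a source. -/
  encRelay : ∀ e : ℰ, (¬ ∃ i, N.tail e = N.source i) →
    ({d : ℰ // N.head d = N.tail e} → (Fin n → B)) → (Fin n → B)
  /-- Decoding function of the sink. -/
  dec : ({e : ℰ // N.head e = N.sink} → (Fin n → B)) → (Fin ℓ → O)

section Code

variable {N : Network ι 𝒱 ℰ} {A B O : Type*} {ℓ n : ℕ} {K : ι → Type}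

open Classical in
/-- The global encoding function of the edge `e`: the message on `e`, as a function of the source
messages `m` and the keys `k`, obtained by applying the local encoding functions recursively. -/
noncomputable def Code.globalEnc [Finite ℰ] (C : N.Code A B O ℓ n K)
    (m : ι → Fin ℓ → A) (k : ∀ i, K i) : ℰ → (Fin n → B) :=
  N.wellFounded_edge.fix fun e y =>
    if h : ∃ i, N.tail e = N.source i then
      C.encSource h.choose ⟨e, h.choose_spec⟩ (m h.choose) (k h.choose)
    else C.encRelay e h fun d => y d.1 d.2

theorem Code.globalEnc_source [Finite ℰ] (C : N.Code A B O ℓ n K) (m : ι → Fin ℓ → A)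
    (k : ∀ i, K i) (e : ℰ) (i : ι) (h : N.tail e = N.source i) :
    C.globalEnc m k e = C.encSource i ⟨e, h⟩ (m i) (k i) := by
  have hex : ∃ i, N.tail e = N.source i := ⟨i, h⟩
  have hi : hex.choose = i := N.source.injective (hex.choose_spec.symm.trans h)
  rw [Code.globalEnc, WellFounded.fix_eq, dif_pos hex]
  have key : ∀ (j : ι) (hj : N.tail e = N.source j), j = i →
      C.encSource j ⟨e, hj⟩ (m j) (k j) = C.encSource i ⟨e, h⟩ (m i) (k i) := by
    rintro j hj rfl
    rfl
  exact key _ _ hi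

theorem Code.globalEnc_relay [Finite ℰ] (C : N.Code A B O ℓ n K) (m : ι → Fin ℓ → A)
    (k : ∀ i, K i) (e : ℰ) (h : ¬ ∃ i, N.tail e = N.source i) :
    C.globalEnc m k e = C.encRelay e h fun d => C.globalEnc m k d.1 := by
  rw [Code.globalEnc, WellFounded.fix_eq, dif_neg h]

end Code

end Network

/-- The probability that `X = x` under the uniform distribution on a finite space `Ω`. -/
noncomputable def unifProb {Ω α : Type*} (X : Ω → α) (x : α) : ℝ :=
  (Nat.card {ω : Ω // X ω = x} : ℝ) / (Nat.card Ω : ℝ)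

/-- Shannon's mutual information
`I(X; Y) = ∑ P(X = x, Y = y) log (P(X = x, Y = y) / (P(X = x) P(Y = y)))`
of two random variables with finitely many values on a finite uniform probability space. -/
noncomputable def mutualInfo {Ω α β : Type*} [Fintype α] [Fintype β]
    (X : Ω → α) (Y : Ω → β) : ℝ :=
  ∑ x : α, ∑ y : β, unifProb (fun ω => (X ω, Y ω)) (x, y) *
    Real.log (unifProb (fun ω => (X ω, Y ω)) (x, y) / (unifProb X x * unifProb Y y))

/-- The componentwise extension of `f : A ^ ι → O` to messages of length `ℓ`. -/
def blockFun {ι A O : Type*} {ℓ : ℕ} (f : (ι → A) → O) (m : ι → Fin ℓ → A) : Fin ℓ → O :=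
  fun t => f fun i => m i t

namespace Network

variable {ι 𝒱 ℰ : Type*}

open Classical in
/-- Admissibility of a code for target function `f`, security function `g` and collection `𝒲` of
wiretap sets: zero-error decodability, and `I(Y_W; g(M_S)) = 0` for every wiretap set `W`.
Independent uniform messages and keys amount to the uniform distribution on all pairs `(m, k)`. -/
structure Code.Admissible {N : Network ι 𝒱 ℰ} {A B O Q : Type*} {ℓ n : ℕ} {K : ι → Type}
    [Finite ℰ] [Fintype B] [Fintype Q] (C : N.Code A B O ℓ n K)
    (f : (ι → A) → O) (g : (ι → A) → Q) (𝒲 : Set (Finset ℰ)) : Prop where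
  decodable : ∀ (m : ι → Fin ℓ → A) (k : ∀ i, K i),
    C.dec (fun e => C.globalEnc m k e.1) = blockFun f m
  secure : ∀ W ∈ 𝒲,
    mutualInfo (Ω := (ι → Fin ℓ → A) × (∀ i, K i))
      (fun ω => fun e : {e : ℰ // e ∈ W} => C.globalEnc ω.1 ω.2 e.1)
      (fun ω => blockFun g ω.1) = 0

/-- The secure computing rate region: the achievable nonnegative reals. The key sets are
arbitrary nonempty finite sets (a one-point set means that no key is used). -/
def rateRegion (N : Network ι 𝒱 ℰ) {A O Q : Type*} (B : Type*) [Finite ℰ] [Fintype B]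
    [Fintype Q] (f : (ι → A) → O) (g : (ι → A) → Q) (𝒲 : Set (Finset ℰ)) : Set ℝ :=
  {R | 0 ≤ R ∧ ∀ ε : ℝ, 0 < ε → ∃ (ℓ n : ℕ) (K : ι → Type) (C : N.Code A B O ℓ n K),
    0 < n ∧ (∀ i, Finite (K i)) ∧ (∀ i, Nonempty (K i)) ∧ C.Admissible f g 𝒲 ∧
      R - ε < (ℓ : ℝ) / (n : ℝ)}

/-- The secure computing capacity: the largest achievable rate, as an extended nonnegative real
(it is `∞` if arbitrarily large rates are achievable, as for a constant target function). -/
noncomputable def capacity (N : Network ι 𝒱 ℰ) {A O Q : Type*} (B : Type*) [Finite ℰ]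
    [Fintype B] [Fintype Q] (f : (ι → A) → O) (g : (ι → A) → Q) (𝒲 : Set (Finset ℰ)) : ENNReal :=
  sSup (ENNReal.ofReal '' N.rateRegion B f g 𝒲)

/-- The secure computing capacity at security level `r`: the wiretapper may access any set of at
most `r` edges. -/
noncomputable def levelCapacity (N : Network ι 𝒱 ℰ) {A O Q : Type*} (B : Type*) [Finite ℰ]
    [Fintype B] [Fintype Q] (f : (ι → A) → O) (g : (ι → A) → Q) (r : ℕ) : ENNReal :=
  N.capacity B f g {W : Finset ℰ | W.card ≤ r}

end Network

/-- The vector linear function `x ↦ x · M`. -/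
def vecLinear {ι κ 𝔽 : Type*} [Fintype ι] [Field 𝔽] (M : Matrix ι κ 𝔽) (x : ι → 𝔽) : κ → 𝔽 :=
  Matrix.vecMul x M

/-- A `(U, V, α)`-tree: a three-layer network with `U` middle nodes `mid i` and `U V` source nodes
`source (i, j)`, where `mid i` is connected to the sink and to the sources `source (i, j)`, with
`α` parallel edges between any two connected nodes. -/
structure UVTree (U V α : ℕ) (𝒱 ℰ : Type*) extends Network (Fin U × Fin V) 𝒱 ℰ where
  /-- The middle nodes. -/
  mid : Fin U ↪ 𝒱
  mid_ne_source : ∀ i p, mid i ≠ source p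
  mid_ne_sink : ∀ i, mid i ≠ sink
  vertex_cases : ∀ v, (∃ p, v = source p) ∨ (∃ i, v = mid i) ∨ v = sink
  edge_cases : ∀ e, (∃ i j, tail e = source (i, j) ∧ head e = mid i) ∨
    (∃ i, tail e = mid i ∧ head e = sink)
  card_source_mid : ∀ i j, Nat.card {e // tail e = source (i, j) ∧ head e = mid i} = α
  card_mid_sink : ∀ i, Nat.card {e // tail e = mid i ∧ head e = sink} = α

namespace UVTree

variable {U V α : ℕ} {𝒱 ℰ : Type*}

/-- The vertex set of the `i`-th branch. -/
def branchVerts (T : UVTree U V α 𝒱 ℰ) (i : Fin U) : Set 𝒱 :=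
  {v | v = T.mid i ∨ v = T.sink ∨ ∃ j, v = T.source (i, j)}

/-- The edge set of the `i`-th branch: all edges of the tree between vertices of the branch. -/
def branchEdges (T : UVTree U V α 𝒱 ℰ) (i : Fin U) : Set ℰ :=
  {e | T.tail e ∈ T.branchVerts i ∧ T.head e ∈ T.branchVerts i}

theorem exists_mid_sink (T : UVTree U V α 𝒱 ℰ) (i : Fin U) :
    ∃ e, T.tail e = T.mid i ∧ T.head e = T.sink := by
  obtain ⟨w, ⟨e, he, -⟩, -⟩ :=
    Relation.TransGen.head'_iff.1 (T.path_to_sink (T.mid i) (T.mid_ne_sink i))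
  rcases T.edge_cases e with ⟨i', j, h1, -⟩ | ⟨i', h1, h2⟩
  · exact absurd (he.symm.trans h1) (T.mid_ne_source i _)
  · exact ⟨e, he, h2⟩

theorem exists_source_mid (T : UVTree U V α 𝒱 ℰ) (i : Fin U) (j : Fin V) :
    ∃ e, T.tail e = T.source (i, j) ∧ T.head e = T.mid i := by
  obtain ⟨w, ⟨e, he, -⟩, -⟩ :=
    Relation.TransGen.head'_iff.1
      (T.path_to_sink (T.source (i, j)) (T.sink_ne_source (i, j)).symm)
  rcases T.edge_cases e with ⟨i', j', h1, h2⟩ | ⟨i', h1, -⟩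
  · have h3 := T.source.injective (he.symm.trans h1)
    simp only [Prod.mk.injEq] at h3
    exact ⟨e, he, by rw [h2, h3.1]⟩
  · exact absurd (h1.symm.trans he) (T.mid_ne_source i' _)

/-- The `i`-th branch of the tree: the subnetwork on `mid i`, the sink and the sources
`source (i, j)`, with all edges of the tree between these vertices. -/
def branch (T : UVTree U V α 𝒱 ℰ) (i : Fin U) :
    Network (Fin V) (T.branchVerts i) (T.branchEdges i) where
  tail e := ⟨T.tail e.1, e.2.1⟩
  head e := ⟨T.head e.1, e.2.2⟩
  source := ⟨fun j => ⟨T.source (i, j), Or.inr (Or.inr ⟨j, rfl⟩)⟩, fun a b h => by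
    have h2 := T.source.injective (congrArg Subtype.val h)
    exact congrArg Prod.snd h2⟩
  sink := ⟨T.sink, Or.inr (Or.inl rfl)⟩
  acyclic v h := T.acyclic v.1 (Relation.TransGen.lift
      (p := fun u w => ∃ e, T.tail e = u ∧ T.head e = w) Subtype.val (fun a b hab => by
    obtain ⟨e, h1, h2⟩ := hab
    exact ⟨e.1, congrArg Subtype.val h1, congrArg Subtype.val h2⟩) _ _ h)
  sink_ne_source j h := T.sink_ne_source (i, j) (congrArg Subtype.val h)
  head_ne_source e j h := T.head_ne_source e.1 (i, j) (congrArg Subtype.val h)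
  path_to_sink u hu := by
    obtain ⟨e, h1, h2⟩ := T.exists_mid_sink i
    have hm : T.mid i ∈ T.branchVerts i := Or.inl rfl
    have hs : T.sink ∈ T.branchVerts i := Or.inr (Or.inl rfl)
    have hstep : Relation.TransGen
        (fun u w : T.branchVerts i => ∃ e : T.branchEdges i,
          (⟨T.tail e.1, e.2.1⟩ : T.branchVerts i) = u ∧
          (⟨T.head e.1, e.2.2⟩ : T.branchVerts i) = w) ⟨T.mid i, hm⟩ ⟨T.sink, hs⟩ :=
      Relation.TransGen.single
        ⟨⟨e, by rw [h1]; exact hm, by rw [h2]; exact hs⟩, Subtype.ext h1, Subtype.ext h2⟩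
    obtain ⟨u, rfl | rfl | ⟨j, rfl⟩⟩ := u
    · exact hstep
    · exact absurd rfl hu
    · obtain ⟨e', h1', h2'⟩ := T.exists_source_mid i j
      exact Relation.TransGen.head
        ⟨⟨e', by rw [h1']; exact Or.inr (Or.inr ⟨j, rfl⟩), by rw [h2']; exact hm⟩,
          Subtype.ext h1', Subtype.ext h2'⟩ hstep

/-- The rows of a coefficient matrix that belong to the sources of the `i`-th branch. -/
def branchMatrix {κ 𝔽 : Type*} (M : Matrix (Fin U × Fin V) κ 𝔽) (i : Fin U) :
    Matrix (Fin V) κ 𝔽 :=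
  Matrix.of fun j c => M (i, j) c

end UVTree

/-! ### Independence and mutual information on a finite uniform space. -/

section UnifProb

variable {Ω α β : Type*}

/-! The branches share no sources and no edges, and both `f` and `g` are sums over the branches of
`f_i` and `g_i`. So codes for the branches with common parameters can run side by side, the sink
adding the decoded values. A wiretap set of at most `r` edges meets each branch in at most `r`
edges, so on each branch the observation is independent of `g_i`. Messages and keys of different
branches are independent, hence all observations together are independent of the family `(g_i)`, and
of its sum `g` (`combine_admissible`).

Vanishing mutual information is turned into independence by the equality case of Gibbs' inequality
(`unifIndep_of_mutualInfo_eq_zero`), since independence passes easily to products and images.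

Common parameters come from repeating each code (`Code.repeated`) until the message lengths agree,
then padding edge messages to the longest block length. The resulting rate is that of the branch
with the longest block, so it still exceeds any `R` below all branch capacities
(`iInf_levelCapacity_le`).

The equality of the two minima holds because capacity decreases in the security level and the whole
of `r` may be assigned to one branch. -/

theorem unifProb_nonneg (X : Ω → α) (x : α) : 0 ≤ unifProb X x := by
  unfold unifProb; positivity

theorem unifProb_comp_equiv {Ω' : Type*} (e : Ω ≃ Ω') (X : Ω' → α) (x : α) :
    unifProb (X ∘ e) x = unifProb X x := by
  unfold unifProb
  rw [Nat.card_congr e,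
    Nat.card_congr (e.subtypeEquiv (p := fun ω => (X ∘ e) ω = x) (q := fun ω => X ω = x)
      (fun _ => Iff.rfl))]

open Classical in
theorem unifProb_comp [Finite Ω] [Fintype α] (φ : α → β) (X : Ω → α) (b : β) :
    unifProb (φ ∘ X) b = ∑ a, if φ a = b then unifProb X a else 0 := by
  have := Fintype.ofFinite Ω
  unfold unifProb
  simp only [Nat.card_eq_fintype_card, Fintype.card_subtype, Function.comp_apply]
  have h : (Finset.univ.filter fun ω => φ (X ω) = b).card
      = ∑ a, if φ a = b then (Finset.univ.filter fun ω => X ω = a).card else 0 := by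
    rw [Finset.card_eq_sum_card_fiberwise (f := X) (t := Finset.univ) (by simp)]
    refine Finset.sum_congr rfl fun a _ => ?_
    rw [Finset.filter_filter]
    split_ifs with ha
    · congr 1
      ext ω
      simp only [Finset.mem_filter, Finset.mem_univ, true_and, and_iff_right_iff_imp]
      rintro rfl
      exact ha
    · rw [Finset.card_eq_zero, Finset.filter_eq_empty_iff]
      rintro ω - ⟨h1, rfl⟩
      exact ha h1
  rw [h]
  push_cast
  rw [Finset.sum_div]
  refine Finset.sum_congr rfl fun a _ => ?_
  split_ifs <;> simp

theorem unifProb_pi {τ : Type*} [Fintype τ] {Ω α : τ → Type*} (X : ∀ t, Ω t → α t)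
    (x : ∀ t, α t) :
    unifProb (fun ω : ∀ t, Ω t => fun t => X t (ω t)) x = ∏ t, unifProb (X t) (x t) := by
  unfold unifProb
  rw [Finset.prod_div_distrib, Nat.card_pi, ← Nat.cast_prod, ← Nat.cast_prod]
  congr 2
  rw [← Nat.card_pi]
  refine Nat.card_congr ((Equiv.subtypeEquivRight fun ω => ?_).trans
    (Equiv.subtypePiEquivPi (p := fun t (ω : Ω t) => X t ω = x t)))
  exact funext_iff

theorem sum_unifProb [Finite Ω] [Nonempty Ω] [Fintype α] (X : Ω → α) :
    ∑ x, unifProb X x = 1 := by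
  classical
  have h := unifProb_comp (fun _ : α => ()) X ()
  simp only [if_true] at h
  rw [← h]
  unfold unifProb
  rw [Nat.card_congr (Equiv.subtypeUnivEquiv fun _ => rfl)]
  exact div_self (Nat.cast_ne_zero.2 Nat.card_pos.ne')

theorem unifProb_pair_eq_zero_of_left [Finite Ω] (X : Ω → α) (Y : Ω → β) {x : α} (y : β)
    (h : unifProb X x = 0) : unifProb (fun ω => (X ω, Y ω)) (x, y) = 0 := by
  unfold unifProb at h ⊢
  rcases div_eq_zero_iff.1 h with h | h
  · have h0 : Nat.card {ω : Ω // (X ω, Y ω) = (x, y)} ≤ Nat.card {ω : Ω // X ω = x} :=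
      Nat.card_le_card_of_injective
        (fun ω => ⟨ω.1, congrArg Prod.fst ω.2⟩) fun a b hab => by
          simpa [Subtype.ext_iff] using hab
    rw [Nat.cast_eq_zero] at h
    rw [Nat.le_zero.1 (h0.trans_eq h), Nat.cast_zero, zero_div]
  · simp [h]

/-- Independence of two random variables on a finite uniform probability space. -/
def UnifIndep (X : Ω → α) (Y : Ω → β) : Prop :=
  ∀ x y, unifProb (fun ω => (X ω, Y ω)) (x, y) = unifProb X x * unifProb Y y

theorem UnifIndep.mutualInfo_eq_zero {_ : Fintype α} {_ : Fintype β} {X : Ω → α} {Y : Ω → β}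
    (h : UnifIndep X Y) : mutualInfo X Y = 0 := by
  refine Finset.sum_eq_zero fun x _ => Finset.sum_eq_zero fun y _ => ?_
  rw [h x y]
  by_cases h0 : unifProb X x * unifProb Y y = 0
  · simp [h0]
  · simp [div_self h0]

/-- Gibbs' inequality for a single term with its equality case, from `log t ≤ t - 1` at `t = q / p`,
strict unless `t = 1`. -/
theorem sub_le_mul_log_div {p q : ℝ} (hp : 0 ≤ p) (hq : 0 ≤ q) (h : q = 0 → p = 0) :
    p - q ≤ p * Real.log (p / q) ∧ (p * Real.log (p / q) = p - q → p = q) := by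
  rcases hp.eq_or_lt with rfl | hp
  · constructor
    · simpa using hq
    · intro h
      simp at h
      exact h.symm
  · have hq' : 0 < q := hq.lt_of_ne fun h0 => hp.ne' (h h0.symm)
    have hlog : Real.log (p / q) = -Real.log (q / p) := by
      rw [← Real.log_inv, inv_div]
    have hpq : p * (q / p - 1) = q - p := by field_simp
    constructor
    · have := mul_le_mul_of_nonneg_left (Real.log_le_sub_one_of_pos (div_pos hq' hp)) hp.le
      rw [hlog]
      linarith
    · intro heq
      by_contra hne
      have h1 : q / p ≠ 1 := fun h1 => hne ((div_eq_one_iff_eq hp.ne').1 h1).symm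
      have := mul_lt_mul_of_pos_left (Real.log_lt_sub_one_of_pos (div_pos hq' hp) h1) hp
      rw [hlog] at heq
      linarith

/-- The joint law and the product of the marginals both have total mass 1, so the termwise lower
bounds `p - q` sum to 0. If the mutual information is also 0, every termwise inequality is an
equality. -/
theorem unifIndep_of_mutualInfo_eq_zero [Finite Ω] [Nonempty Ω] {_ : Fintype α} {_ : Fintype β}
    {X : Ω → α} {Y : Ω → β} (h : mutualInfo X Y = 0) : UnifIndep X Y := by
  have key (z : α × β) := sub_le_mul_log_div
    (unifProb_nonneg (fun ω => (X ω, Y ω)) z)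
    (mul_nonneg (unifProb_nonneg X z.1) (unifProb_nonneg Y z.2)) (fun h0 => by
      rcases mul_eq_zero.1 h0 with h0 | h0
      · exact unifProb_pair_eq_zero_of_left X Y z.2 h0
      · rw [← unifProb_pair_eq_zero_of_left Y X z.1 h0]
        unfold unifProb
        congr 2
        refine Nat.card_congr (Equiv.subtypeEquivRight fun ω => ?_)
        rw [Prod.ext_iff, Prod.ext_iff]
        exact and_comm)
  have hsum : ∑ z : α × β, (unifProb (fun ω => (X ω, Y ω)) z - unifProb X z.1 * unifProb Y z.2)
      = ∑ z : α × β, unifProb (fun ω => (X ω, Y ω)) z *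
        Real.log (unifProb (fun ω => (X ω, Y ω)) z / (unifProb X z.1 * unifProb Y z.2)) := by
    rw [Finset.sum_sub_distrib, sum_unifProb, Fintype.sum_prod_type, Fintype.sum_prod_type]
    simp_rw [← Finset.mul_sum]
    rw [sum_unifProb]
    simp_rw [mul_one]
    rw [sum_unifProb, sub_self]
    exact h.symm
  intro x y
  exact (key (x, y)).2
    ((Finset.sum_eq_sum_iff_of_le fun z _ => (key z).1).1 hsum (x, y) (Finset.mem_univ _)).symm

theorem UnifIndep.comp_equiv {Ω' : Type*} {X : Ω → α} {Y : Ω → β} (h : UnifIndep X Y)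
    (e : Ω' ≃ Ω) : UnifIndep (X ∘ e) (Y ∘ e) := by
  intro x y
  rw [unifProb_comp_equiv, unifProb_comp_equiv, ← h x y]
  exact unifProb_comp_equiv e (fun ω => (X ω, Y ω)) (x, y)

theorem UnifIndep.comp [Finite Ω] [Finite α] [Finite β] {α' β' : Type*} {X : Ω → α} {Y : Ω → β}
    (h : UnifIndep X Y) (φ : α → α') (ψ : β → β') : UnifIndep (φ ∘ X) (ψ ∘ Y) := by
  classical
  have := Fintype.ofFinite α
  have := Fintype.ofFinite β
  intro x y
  have hp := unifProb_comp (Prod.map φ ψ) (fun ω => (X ω, Y ω)) (x, y)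
  rw [unifProb_comp, unifProb_comp, Finset.sum_mul_sum]
  refine hp.trans ?_
  rw [Fintype.sum_prod_type]
  refine Finset.sum_congr rfl fun a _ => Finset.sum_congr rfl fun b _ => ?_
  rw [h a b]
  by_cases h1 : φ a = x <;> by_cases h2 : ψ b = y <;> simp [h1, h2]

/-- The uniform law on a product space is a product measure, so joint and marginal probabilities all
factor over the coordinates. Used both for the rounds of a repeated code and for the branches of the
tree. -/
theorem UnifIndep.pi {τ : Type*} [Finite τ] {Ω α β : τ → Type*} {X : ∀ t, Ω t → α t}
    {Y : ∀ t, Ω t → β t} (h : ∀ t, UnifIndep (X t) (Y t)) :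
    UnifIndep (fun ω : ∀ t, Ω t => fun t => X t (ω t))
      (fun ω : ∀ t, Ω t => fun t => Y t (ω t)) := by
  have := Fintype.ofFinite τ
  intro x y
  rw [unifProb_pi, unifProb_pi, ← Finset.prod_mul_distrib]
  simp_rw [← h _ _ _]
  rw [← unifProb_pi (fun t ω => (X t ω, Y t ω)) (fun t => (x t, y t))]
  unfold unifProb
  congr 2
  refine Nat.card_congr (Equiv.subtypeEquivRight fun ω => ?_)
  simp only [Prod.mk.injEq, funext_iff, forall_and]

end UnifProb

/-! ### Repeating a code in independent rounds, with padding. -/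

namespace Network

section Repeat

variable {ι 𝒱 ℰ : Type*} {N : Network ι 𝒱 ℰ} {A B O : Type*} {ℓ n : ℕ} {K : ι → Type}

/-- The part of a message of length `ℓ * k` that belongs to the `t`-th round. -/
def roundMsg {k : ℕ} (m : Fin (ℓ * k) → A) (t : Fin k) : Fin ℓ → A :=
  fun s => m (finProdFinEquiv (s, t))

/-- The code that uses `C` in `k` independent rounds; the `k` messages on an edge are packed into
one message of length `n'`. -/
def Code.repeated (C : N.Code A B O ℓ n K) {k n' : ℕ} (pack : (Fin k → Fin n → B) → Fin n' → B)
    (unpack : (Fin n' → B) → Fin k → Fin n → B) :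
    N.Code A B O (ℓ * k) n' (fun i => Fin k → K i) where
  encSource i e m κ := pack fun t => C.encSource i e (roundMsg m t) (κ t)
  encRelay e h y := pack fun t => C.encRelay e h fun d => unpack (y d) t
  dec y s := C.dec (fun e => unpack (y e) (finProdFinEquiv.symm s).2) (finProdFinEquiv.symm s).1

/-- Induction along the edges: each relay unpacks its inputs, which recovers the messages of the
separate rounds. -/
theorem Code.globalEnc_repeated [Finite ℰ] (C : N.Code A B O ℓ n K) {k n' : ℕ}
    {pack : (Fin k → Fin n → B) → Fin n' → B} {unpack : (Fin n' → B) → Fin k → Fin n → B}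
    (h : ∀ y, unpack (pack y) = y) (m : ι → Fin (ℓ * k) → A) (κ : ∀ i, Fin k → K i) (e : ℰ) :
    (C.repeated pack unpack).globalEnc m κ e
      = pack fun t => C.globalEnc (fun i => roundMsg (m i) t) (fun i => κ i t) e := by
  induction e using N.wellFounded_edge.induction with
  | _ e ih =>
    by_cases hs : ∃ i, N.tail e = N.source i
    · obtain ⟨i, hi⟩ := hs
      simp_rw [Code.globalEnc_source _ _ _ e i hi]
      rfl
    · simp_rw [Code.globalEnc_relay _ _ _ e hs]
      simp only [Code.repeated]
      congr 1
      funext t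
      congr 1
      funext d
      have := ih d.1 d.2
      simp only [Code.repeated] at this
      rw [this, h]

theorem exists_pack [Nonempty B] {k n n' : ℕ} (h : k * n ≤ n') :
    ∃ (pack : (Fin k → Fin n → B) → Fin n' → B) (unpack : (Fin n' → B) → Fin k → Fin n → B),
      ∀ y, unpack (pack y) = y := by
  classical
  let σ : Fin k × Fin n → Fin n' := fun p => Fin.castLE h (finProdFinEquiv p)
  have hσ : Function.Injective σ := (Fin.castLE_injective h).comp finProdFinEquiv.injective
  -- Positions outside the range of `σ` are padding and carry an arbitrary letter.
  refine ⟨fun y => Function.extend σ (fun p => y p.1 p.2) fun _ => Classical.arbitrary B,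
    fun z a b => z (σ (a, b)), fun y => ?_⟩
  funext a b
  exact hσ.extend_apply _ _ (a, b)

/-- Messages and keys for `k` rounds are `k`-tuples of messages and keys for one round. -/
def roundEquiv (ι A : Type*) (ℓ k : ℕ) (K : ι → Type) :
    ((ι → Fin (ℓ * k) → A) × (∀ i, Fin k → K i)) ≃
      (Fin k → (ι → Fin ℓ → A) × (∀ i, K i)) where
  toFun ω t := (fun i => roundMsg (ω.1 i) t, fun i => ω.2 i t)
  invFun η := (fun i s => (η (finProdFinEquiv.symm s).2).1 i (finProdFinEquiv.symm s).1,
    fun i t => (η t).2 i)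
  left_inv ω := by
    ext i s
    · simp only [roundMsg, Prod.mk.eta, Equiv.apply_symm_apply]
    · rfl
  right_inv η := by
    funext t
    ext i s
    · simp only [roundMsg, Equiv.symm_apply_apply]
    · rfl

theorem Code.Admissible.unifIndep [Finite ι] [Finite ℰ] [Finite A] [Nonempty A] [Fintype B]
    {Q : Type*} [Fintype Q] [∀ i, Finite (K i)] [∀ i, Nonempty (K i)] {C : N.Code A B O ℓ n K}
    {f : (ι → A) → O} {g : (ι → A) → Q} {𝒲 : Set (Finset ℰ)} (hC : C.Admissible f g 𝒲)
    {W : Finset ℰ} (hW : W ∈ 𝒲) :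
    UnifIndep (Ω := (ι → Fin ℓ → A) × (∀ i, K i))
      (fun ω => fun e : {e : ℰ // e ∈ W} => C.globalEnc ω.1 ω.2 e.1)
      (fun ω => blockFun g ω.1) :=
  unifIndep_of_mutualInfo_eq_zero (hC.secure W hW)

theorem Code.Admissible.repeated [Finite ι] [Finite ℰ] [Finite A] [Nonempty A] [Fintype B]
    {Q : Type*} [Fintype Q] [∀ i, Finite (K i)] [∀ i, Nonempty (K i)] {C : N.Code A B O ℓ n K}
    {f : (ι → A) → O} {g : (ι → A) → Q} {𝒲 : Set (Finset ℰ)} (hC : C.Admissible f g 𝒲)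
    {k n' : ℕ} {pack : (Fin k → Fin n → B) → Fin n' → B}
    {unpack : (Fin n' → B) → Fin k → Fin n → B} (h : ∀ y, unpack (pack y) = y) :
    (C.repeated pack unpack).Admissible f g 𝒲 where
  decodable m κ := by
    funext s
    simp_rw [Code.globalEnc_repeated C h]
    simp only [Code.repeated, h]
    rw [hC.decodable]
    simp only [blockFun, roundMsg, Prod.mk.eta, Equiv.apply_symm_apply]
  secure W hW := by
    refine UnifIndep.mutualInfo_eq_zero ?_
    -- The observation is the packed family of the round observations, and the security value
    -- reassembles those of the rounds; both are images of independent variables.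
    have := ((UnifIndep.pi fun _ : Fin k => hC.unifIndep hW).comp
      (fun (y : Fin k → {e : ℰ // e ∈ W} → Fin n → B) (e : {e : ℰ // e ∈ W}) =>
        pack fun t => y t e)
      (fun (z : Fin k → Fin ℓ → Q) (s : Fin (ℓ * k)) =>
        z (finProdFinEquiv.symm s).2 (finProdFinEquiv.symm s).1)).comp_equiv
          (roundEquiv ι A ℓ k K)
    convert this using 1
    · funext ω e
      exact Code.globalEnc_repeated C h _ _ _
    · funext ω s
      simp only [Function.comp_apply, blockFun, roundEquiv, roundMsg, Equiv.coe_fn_mk,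
        Prod.mk.eta, Equiv.apply_symm_apply]

end Repeat

/-! ### Capacity: monotonicity and passage to and from codes. -/

section Capacity

variable {ι 𝒱 ℰ A B O Q : Type*} [Finite ℰ] [Fintype B] [Fintype Q]

theorem capacity_anti (N : Network ι 𝒱 ℰ) (f : (ι → A) → O) (g : (ι → A) → Q)
    {𝒲 𝒲' : Set (Finset ℰ)} (h : 𝒲 ⊆ 𝒲') : N.capacity B f g 𝒲' ≤ N.capacity B f g 𝒲 := by
  refine sSup_le_sSup (Set.image_mono ?_)
  rintro R ⟨hR, hc⟩
  refine ⟨hR, fun ε hε => ?_⟩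
  obtain ⟨ℓ, n, K, C, hn, hf, hne, hC, hlt⟩ := hc ε hε
  exact ⟨ℓ, n, K, C, hn, hf, hne, ⟨hC.decodable, fun W hW => hC.secure W (h hW)⟩, hlt⟩

theorem levelCapacity_anti (N : Network ι 𝒱 ℰ) (f : (ι → A) → O) (g : (ι → A) → Q) :
    Antitone (N.levelCapacity B f g) := fun _ _ h =>
  N.capacity_anti f g fun _ hW => le_trans hW h

theorem exists_code_of_lt_capacity {N : Network ι 𝒱 ℰ} {f : (ι → A) → O} {g : (ι → A) → Q}
    {𝒲 : Set (Finset ℰ)} {R : ℝ} (hR : 0 ≤ R) (h : ENNReal.ofReal R < N.capacity B f g 𝒲) :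
    ∃ (ℓ n : ℕ) (K : ι → Type) (C : N.Code A B O ℓ n K), 0 < ℓ ∧ 0 < n ∧
      (∀ i, Finite (K i)) ∧ (∀ i, Nonempty (K i)) ∧ C.Admissible f g 𝒲 ∧ R < (ℓ : ℝ) / n := by
  obtain ⟨_, ⟨R', ⟨-, hR'⟩, rfl⟩, hlt⟩ := lt_sSup_iff.1 h
  have hlt' : R < R' := (ENNReal.ofReal_lt_ofReal_iff_of_nonneg hR).1 hlt
  obtain ⟨ℓ, n, K, C, hn, hf, hne, hC, hrate⟩ := hR' (R' - R) (sub_pos.2 hlt')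
  rw [sub_sub_cancel] at hrate
  -- A code with `ℓ = 0` has rate 0, which cannot exceed `R ≥ 0`. Positivity of `ℓ` is what later
  -- allows a common positive multiple of the message lengths.
  refine ⟨ℓ, n, K, C, Nat.pos_of_ne_zero ?_, hn, hf, hne, hC, hrate⟩
  rintro rfl
  simp only [Nat.cast_zero, zero_div] at hrate
  exact hR.not_gt hrate

theorem le_capacity_of_code {N : Network ι 𝒱 ℰ} {f : (ι → A) → O} {g : (ι → A) → Q}
    {𝒲 : Set (Finset ℰ)} {ℓ n : ℕ} {K : ι → Type} [∀ i, Finite (K i)] [∀ i, Nonempty (K i)]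
    (C : N.Code A B O ℓ n K) (hn : 0 < n) (hC : C.Admissible f g 𝒲) :
    ENNReal.ofReal ((ℓ : ℝ) / n) ≤ N.capacity B f g 𝒲 :=
  le_sSup ⟨_, ⟨by positivity, fun _ hε => ⟨ℓ, n, K, C, hn, inferInstance, inferInstance, hC,
    sub_lt_self _ hε⟩⟩, rfl⟩

end Capacity

end Network

/-! ### Combining codes on the branches into a code on the tree. -/

namespace UVTree

variable {U V α : ℕ} {𝒱 ℰ : Type*}

theorem mem_branchEdges_of_tail_source (T : UVTree U V α 𝒱 ℰ) {e : ℰ} {p : Fin U × Fin V}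
    (h : T.tail e = T.source p) : e ∈ T.branchEdges p.1 := by
  refine ⟨Or.inr (Or.inr ⟨p.2, h⟩), ?_⟩
  rcases T.edge_cases e with ⟨i, j, h1, h2⟩ | ⟨i, h1, -⟩
  · obtain rfl := T.source.injective (h.symm.trans h1)
    exact Or.inl h2
  · exact absurd (h1.symm.trans h) (T.mid_ne_source _ _)

theorem head_of_tail_mid (T : UVTree U V α 𝒱 ℰ) {e : ℰ} {i : Fin U}
    (h : T.tail e = T.mid i) : T.head e = T.sink := by
  rcases T.edge_cases e with ⟨i', j, h1, -⟩ | ⟨-, -, h2⟩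
  · exact absurd (h.symm.trans h1) (T.mid_ne_source _ _)
  · exact h2

theorem mem_branchEdges_of_tail_mid (T : UVTree U V α 𝒱 ℰ) {e : ℰ} {i : Fin U}
    (h : T.tail e = T.mid i) : e ∈ T.branchEdges i :=
  ⟨Or.inl h, Or.inr (Or.inl (T.head_of_tail_mid h))⟩

theorem exists_tail_mid (T : UVTree U V α 𝒱 ℰ) {e : ℰ} (h : ¬ ∃ p, T.tail e = T.source p) :
    ∃ i, T.tail e = T.mid i := by
  rcases T.edge_cases e with ⟨i, j, h1, -⟩ | ⟨i, h1, -⟩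
  · exact absurd ⟨_, h1⟩ h
  · exact ⟨i, h1⟩

theorem exists_mem_branchEdges (T : UVTree U V α 𝒱 ℰ) (e : ℰ) : ∃ i, e ∈ T.branchEdges i := by
  by_cases h : ∃ p, T.tail e = T.source p
  · obtain ⟨p, hp⟩ := h
    exact ⟨_, T.mem_branchEdges_of_tail_source hp⟩
  · obtain ⟨i, hi⟩ := T.exists_tail_mid h
    exact ⟨i, T.mem_branchEdges_of_tail_mid hi⟩

theorem branch_tail_ne_source (T : UVTree U V α 𝒱 ℰ) {i : Fin U} {e : T.branchEdges i}
    (h : ¬ ∃ p, T.tail e = T.source p) :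
    ¬ ∃ j, (T.branch i).tail e = (T.branch i).source j :=
  fun ⟨j, hj⟩ => h ⟨(i, j), congrArg Subtype.val hj⟩

section Combine

variable {A B O : Type*} {ℓ n : ℕ} {K : Fin U → Fin V → Type}

/-- The code on the tree that uses a code on every branch, where the sink adds up the values
decoded from the branches. -/
noncomputable def combine [AddCommMonoid O] (T : UVTree U V α 𝒱 ℰ)
    (C : ∀ i, (T.branch i).Code A B O ℓ n (K i)) :
    T.toNetwork.Code A B O ℓ n (fun p => K p.1 p.2) where
  encSource p e m κ := (C p.1).encSource p.2
    ⟨⟨e.1, T.mem_branchEdges_of_tail_source e.2⟩, Subtype.ext e.2⟩ m κ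
  encRelay e h y := (C (T.exists_tail_mid h).choose).encRelay
    ⟨e, T.mem_branchEdges_of_tail_mid (T.exists_tail_mid h).choose_spec⟩
    (T.branch_tail_ne_source h) fun d => y ⟨d.1.1, congrArg Subtype.val d.2⟩
  dec y := ∑ i, (C i).dec fun e => y ⟨e.1.1, congrArg Subtype.val e.2⟩

/-- Removes the choice made in `combine`: the middle node at the tail of an edge determines its
branch. -/
theorem combine_encRelay [AddCommMonoid O] (T : UVTree U V α 𝒱 ℰ)
    (C : ∀ i, (T.branch i).Code A B O ℓ n (K i)) {e : ℰ} (h : ¬ ∃ p, T.tail e = T.source p)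
    {i : Fin U} (hi : T.tail e = T.mid i) (y : {d : ℰ // T.head d = T.tail e} → Fin n → B) :
    (T.combine C).encRelay e h y = (C i).encRelay ⟨e, T.mem_branchEdges_of_tail_mid hi⟩
      (T.branch_tail_ne_source h) fun d => y ⟨d.1.1, congrArg Subtype.val d.2⟩ := by
  have key : ∀ i' (hi' : T.tail e = T.mid i'), i' = i →
      (C i').encRelay ⟨e, T.mem_branchEdges_of_tail_mid hi'⟩
        (T.branch_tail_ne_source h) (fun d => y ⟨d.1.1, congrArg Subtype.val d.2⟩)
      = (C i).encRelay ⟨e, T.mem_branchEdges_of_tail_mid hi⟩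
        (T.branch_tail_ne_source h) fun d => y ⟨d.1.1, congrArg Subtype.val d.2⟩ := by
    rintro i' hi' rfl
    rfl
  exact key _ (T.exists_tail_mid h).choose_spec (T.mid.injective ((T.exists_tail_mid h).choose_spec.symm.trans hi))

theorem globalEnc_combine [Finite ℰ] [AddCommMonoid O] (T : UVTree U V α 𝒱 ℰ)
    (C : ∀ i, (T.branch i).Code A B O ℓ n (K i)) (m : Fin U × Fin V → Fin ℓ → A)
    (κ : ∀ p : Fin U × Fin V, K p.1 p.2) {i : Fin U} (e : T.branchEdges i) :
    (T.combine C).globalEnc m κ e.1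
      = (C i).globalEnc (fun j => m (i, j)) (fun j => κ (i, j)) e := by
  have hsource : ∀ {i : Fin U} (e : T.branchEdges i), (∃ p, T.tail e = T.source p) →
      (T.combine C).globalEnc m κ e.1
        = (C i).globalEnc (fun j => m (i, j)) (fun j => κ (i, j)) e := by
    rintro i ⟨e, he⟩ ⟨p, hp⟩
    have hi : p.1 = i := by
      rcases he.1 with h | h | ⟨j, h⟩
      · exact absurd (h.symm.trans hp) (T.mid_ne_source _ _)
      · exact absurd (h.symm.trans hp) (T.sink_ne_source _)
      · rw [T.source.injective (hp.symm.trans h)]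
    subst hi
    rw [Network.Code.globalEnc_source _ m κ e p hp,
      Network.Code.globalEnc_source (C p.1) _ _ ⟨e, he⟩ p.2 (Subtype.ext hp)]
    rfl
  -- No induction is needed: the inputs of an edge leaving a middle node all leave sources, where
  -- `hsource` applies.
  by_cases hs : ∃ p, T.tail e.1 = T.source p
  · exact hsource e hs
  · obtain ⟨e, he⟩ := e
    have hi : T.tail e = T.mid i := by
      rcases he.1 with h | h | ⟨j, h⟩
      · exact h
      · obtain ⟨i', hi'⟩ := T.exists_tail_mid hs
        exact absurd (hi'.symm.trans h) (T.mid_ne_sink _)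
      · exact absurd ⟨_, h⟩ hs
    rw [Network.Code.globalEnc_relay _ m κ e hs,
      Network.Code.globalEnc_relay (C i) _ _ ⟨e, he⟩ (T.branch_tail_ne_source hs),
      T.combine_encRelay C hs hi]
    congr 1
    funext d
    refine hsource d.1 ?_
    have hd : T.head d.1.1 = T.mid i := (congrArg Subtype.val d.2).trans hi
    rcases T.edge_cases d.1.1 with ⟨i', j, h1, -⟩ | ⟨i', -, h2⟩
    · exact ⟨_, h1⟩
    · exact absurd (hd.symm.trans h2) (T.mid_ne_sink _)

/-- Messages and keys on the tree are families of messages and keys on the branches. -/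
def branchEquiv (A : Type*) (ℓ : ℕ) (K : Fin U → Fin V → Type) :
    ((Fin U × Fin V → Fin ℓ → A) × (∀ p : Fin U × Fin V, K p.1 p.2)) ≃
      (∀ i, (Fin V → Fin ℓ → A) × (∀ j, K i j)) where
  toFun ω i := (fun j => ω.1 (i, j), fun j => ω.2 (i, j))
  invFun η := (fun p => (η p.1).1 p.2, fun p => (η p.1).2 p.2)
  left_inv _ := rfl
  right_inv _ := rfl

theorem vecLinear_eq_sum_branch {κ 𝔽 : Type*} [Field 𝔽] (M : Matrix (Fin U × Fin V) κ 𝔽)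
    (x : Fin U × Fin V → 𝔽) :
    vecLinear M x = ∑ i, vecLinear (branchMatrix M i) fun j => x (i, j) := by
  funext c
  simp only [vecLinear, Matrix.vecMul, dotProduct, branchMatrix, Matrix.of_apply,
    Finset.sum_apply, Fintype.sum_prod_type]

theorem blockFun_vecLinear_eq_sum_branch {κ 𝔽 : Type*} [Field 𝔽]
    (M : Matrix (Fin U × Fin V) κ 𝔽) (m : Fin U × Fin V → Fin ℓ → 𝔽) :
    blockFun (vecLinear M) m
      = ∑ i, blockFun (vecLinear (branchMatrix M i)) fun j => m (i, j) := by
  funext t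
  rw [Finset.sum_apply]
  exact vecLinear_eq_sum_branch M _

theorem combine_admissible {𝔽 : Type*} [Field 𝔽] [Fintype 𝔽] [Fintype B] [Finite ℰ]
    {rf rg r : ℕ} [∀ i j, Finite (K i j)] [∀ i j, Nonempty (K i j)]
    (T : UVTree U V α 𝒱 ℰ) {F : Matrix (Fin U × Fin V) (Fin rf) 𝔽}
    {G : Matrix (Fin U × Fin V) (Fin rg) 𝔽}
    {C : ∀ i, (T.branch i).Code 𝔽 B (Fin rf → 𝔽) ℓ n (K i)}
    (hC : ∀ i, (C i).Admissible (vecLinear (branchMatrix F i)) (vecLinear (branchMatrix G i))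
      {W | W.card ≤ r}) :
    (T.combine C).Admissible (vecLinear F) (vecLinear G) {W | W.card ≤ r} where
  decodable m κ := by
    rw [blockFun_vecLinear_eq_sum_branch]
    change ∑ i, (C i).dec _ = _
    refine Finset.sum_congr rfl fun i _ => ?_
    rw [← (hC i).decodable _ fun j => κ (i, j)]
    congr 1
    funext e
    exact T.globalEnc_combine C m κ e.1
  secure W hW := by
    classical
    refine UnifIndep.mutualInfo_eq_zero ?_
    -- The part of `W` inside each branch has at most `r` edges; the cruder bound by `r` for every
    -- branch is enough.
    let W' (i : Fin U) : Finset (T.branchEdges i) := W.subtype (· ∈ T.branchEdges i)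
    have hW' : ∀ i, W' i ∈ {W : Finset (T.branchEdges i) | W.card ≤ r} := fun i => by
      rw [Set.mem_ofPred_eq, Finset.card_subtype]
      exact (Finset.card_filter_le _ _).trans hW
    choose b hb using T.exists_mem_branchEdges
    have := ((UnifIndep.pi fun i => (hC i).unifIndep (hW' i)).comp
      (fun y (e : {e : ℰ // e ∈ W}) => y (b e.1) ⟨⟨e.1, hb e.1⟩, Finset.mem_subtype.2 e.2⟩)
      (fun z => ∑ i, z i)).comp_equiv (branchEquiv 𝔽 ℓ K)
    convert this using 1
    · funext ω e
      exact T.globalEnc_combine C ω.1 ω.2 ⟨e.1, hb e.1⟩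
    · funext ω
      exact blockFun_vecLinear_eq_sum_branch G ω.1

end Combine

/-! ### Matching the parameters of the branch codes, and the theorem. -/

theorem iInf_levelCapacity_le {𝔽 B : Type*} [Field 𝔽] [Fintype 𝔽] [Fintype B] [Nonempty B]
    [Finite ℰ] {rf rg : ℕ} (hU : 0 < U) (T : UVTree U V α 𝒱 ℰ)
    (F : Matrix (Fin U × Fin V) (Fin rf) 𝔽) (G : Matrix (Fin U × Fin V) (Fin rg) 𝔽) (r : ℕ) :
    ⨅ i : Fin U, (T.branch i).levelCapacity B (vecLinear (branchMatrix F i))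
        (vecLinear (branchMatrix G i)) r
      ≤ T.toNetwork.levelCapacity B (vecLinear F) (vecLinear G) r := by
  refine le_of_forall_lt_imp_le_of_dense fun c hc => ?_
  obtain ⟨R, hR, rfl⟩ : ∃ R : ℝ, 0 ≤ R ∧ c = ENNReal.ofReal R :=
    ⟨c.toReal, ENNReal.toReal_nonneg, (ENNReal.ofReal_toReal hc.ne_top).symm⟩
  have hcode := fun i => Network.exists_code_of_lt_capacity hR (hc.trans_le (iInf_le _ i))
  choose ℓ n K C hℓ hn hfin hne hC hrate using hcode
  have hdvd : ∀ i, ℓ i ∣ ∏ i, ℓ i := fun i => Finset.dvd_prod_of_mem _ (Finset.mem_univ i)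
  have hpos : 0 < ∏ i, ℓ i := Finset.prod_pos fun i _ => hℓ i
  choose k hk using hdvd
  generalize ∏ i, ℓ i = L at hk hpos
  have hne' : (Finset.univ : Finset (Fin U)).Nonempty := ⟨⟨0, hU⟩, Finset.mem_univ _⟩
  -- After `k i` rounds every branch code has message length `L = ℓ i * k i`; the longest block, at
  -- `i₀`, becomes the common block length. The combined rate is then `ℓ i₀ / n i₀`, which exceeds
  -- `R`.
  obtain ⟨i₀, -, hi₀⟩ := Finset.exists_max_image Finset.univ (fun i => k i * n i) hne'
  have hk₀ : 0 < k i₀ := Nat.pos_of_ne_zero fun h => by simp [hk i₀, h] at hpos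
  have hrep : ∀ i, ∃ C' : (T.branch i).Code 𝔽 B (Fin rf → 𝔽) L (k i₀ * n i₀)
      (fun j => Fin (k i) → K i j), C'.Admissible (vecLinear (branchMatrix F i))
        (vecLinear (branchMatrix G i)) {W | W.card ≤ r} := fun i => by
    obtain ⟨pack, unpack, h⟩ := Network.exists_pack (B := B) (hi₀ i (Finset.mem_univ i))
    have := hfin i
    have := hne i
    rw [hk i]
    exact ⟨_, (hC i).repeated h⟩
  choose C' hC' using hrep
  have := fun i j => hfin i j
  have := fun i j => hne i j
  refine le_trans (ENNReal.ofReal_le_ofReal ?_) (Network.le_capacity_of_code (T.combine C')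
    (Nat.mul_pos hk₀ (hn i₀)) (T.combine_admissible hC'))
  refine (hrate i₀).le.trans_eq ?_
  rw [hk i₀, mul_comm (k i₀)]
  push_cast
  rw [mul_div_mul_right _ _ (Nat.cast_ne_zero.2 hk₀.ne')]

end UVTree

theorem mainTheorem8 {𝔽 B 𝒱 ℰ : Type*} [Field 𝔽] [Fintype 𝔽] [Fintype B] [Nonempty B]
    [Finite 𝒱] [Finite ℰ] {U V α rf rg : ℕ} (hU : 0 < U) (T : UVTree U V α 𝒱 ℰ)
    (F : Matrix (Fin U × Fin V) (Fin rf) 𝔽) (G : Matrix (Fin U × Fin V) (Fin rg) 𝔽) (r : ℕ) :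
    (⨅ ρ : {ρ : Fin U → ℕ // ∑ i, ρ i = r}, ⨅ i : Fin U,
        (T.branch i).levelCapacity B (vecLinear (UVTree.branchMatrix F i))
          (vecLinear (UVTree.branchMatrix G i)) (ρ.1 i))
      ≤ T.toNetwork.levelCapacity B (vecLinear F) (vecLinear G) r ∧
    (⨅ ρ : {ρ : Fin U → ℕ // ∑ i, ρ i = r}, ⨅ i : Fin U,
        (T.branch i).levelCapacity B (vecLinear (UVTree.branchMatrix F i))
          (vecLinear (UVTree.branchMatrix G i)) (ρ.1 i))
      = ⨅ i : Fin U, (T.branch i).levelCapacity B (vecLinear (UVTree.branchMatrix F i))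
          (vecLinear (UVTree.branchMatrix G i)) r := by
  refine and_iff_right_of_imp (fun h => h.trans_le (T.iInf_levelCapacity_le hU F G r)) |>.2 ?_
  refine le_antisymm (le_iInf fun i => ?_) (le_iInf fun ρ => iInf_mono fun i => ?_)
  -- The allocation giving all of `r` to branch `i`.
  · refine (iInf_le _ ⟨Pi.single i r, by simp⟩).trans ((iInf_le _ i).trans_eq ?_)
    simp
  -- Each part of an allocation is at most `r`, and a lower level only raises the capacity.
  · refine Network.levelCapacity_anti _ _ _ ?_
    exact (Finset.single_le_sum (fun _ _ => Nat.zero_le _) (Finset.mem_univ i)).trans_eq ρ.2
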